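/- Let $L\ge 1$ and let $X_1,\dots,X_L$ be independent, absolutely continuous, almost surely nonnegative real random variables with densities $f_{X_\ell}$. Let $\Psi,\beta,\theta>0$ and let $(\eta_i)_{i\ge 0}$ be real numbers with $\eta_0\neq 0$. Suppose that for every $\ell$ the Laplace transform $\mathscr L\{f_{X_\ell}\}(s)=\int_0^\infty e^{-sx}f_{X_\ell}(x)\,dx$ has the form $$\mathscr L\{f_{X_\ell}\}(s)=\Psi\sum_{i=0}^\infty \eta_i\,s^{-\beta-i\theta}$$ in one of the following two senses: (a) (convergent case) there is $\sigma>0$ such that for all $s\in\mathbb C$ with $\operatorname{Re}s>\sigma$ the series converges absolutely and the equality holds; (b) (divergent case; the series is understood as a Borel sum) there is $\varepsilon>0$ such that $\lim_{i\to\infty}|\eta_i|\,r^i/\Gamma(i\theta+\varepsilon)=0$ for every $r>0$, and, with $B(x)=\sum_{i=0}^\infty \eta_i x^{i\theta+\beta-1}/\Gamma(i\theta+\beta)$ for $x>0$, there is $\sigma>0$ such that for all $s\in\mathbb C$ with $\operatorname{Re}s>\sigma$ the function $e^{-sx}B(x)$ is integrable on $(0,\infty)$ and $\mathscr L\{f_{X_\ell}\}(s)=\Psi\int_0^\infty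 e^{-sx}B(x)\,dx$. Define $$\delta_0=\eta_0^L,\qquad \delta_i=\frac{1}{i\,\eta_0}\sum_{h=1}^{i}\delta_{i-h}\,\eta_h\,(hL+h-i)\quad(i\ge 1).$$ Then $X=\sum_{\ell=1}^L X_\ell$ is absolutely continuous; it has a density $f_X$ vanishing on $(-\infty,0]$ with $$f_X(x)=\Psi^L\sum_{i=0}^\infty\frac{\delta_i\,x^{i\theta+L\beta-1}}{\Gamma(i\theta+L\beta)}\ \ (x>0),$$ and its distribution function satisfies $$F_X(x)=\Psi^L\sum_{i=0}^\infty\frac{\delta_i\,x^{i\theta+L\beta}}{\Gamma(1+i\theta+L\beta)}\ \ (x\ge 0).$$ Both series converge absolutely for all the indicated $x$, and the right-hand side of the first formula is nonnegative for every $x>0$. Moreover, $\sum_{i\ge 0}\delta_i z^i=\bigl(\sum_{i\ge 0}\eta_i z^i\bigr)^L$ as formal power series. -/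

import Mathlib

open MeasureTheory ProbabilityTheory Filter Topology

noncomputable section

namespace LaplaceSum

/-- The (one-sided) Laplace transform `∫₀^∞ e^{-s x} f(x) dx` of a real function, `s ∈ ℂ`. -/
def laplace (f : ℝ → ℝ) (s : ℂ) : ℂ :=
  ∫ x in Set.Ioi (0 : ℝ), Complex.exp (-s * (x : ℂ)) * (f x : ℂ)

/-- A real-valued version of the density of the real random variable `X`. -/
def density {Ω : Type*} [MeasurableSpace Ω] (P : Measure Ω) (X : Ω → ℝ) (x : ℝ) : ℝ :=
  (pdf X P volume x).toReal

/-- The `i`-th term `η_i s^{-β - iθ}` of the series for the Laplace transform. -/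
def laplaceTerm (β θ : ℝ) (η : ℕ → ℝ) (s : ℂ) (i : ℕ) : ℂ :=
  (η i : ℂ) * s ^ (-(β : ℂ) - (i : ℂ) * (θ : ℂ))

/-- Convergent case: on some right half-plane the series `∑ η_i s^{-β - iθ}` converges
absolutely, and `Ψ` times its sum is the Laplace transform of `f`. -/
def HasConvergentForm (f : ℝ → ℝ) (Ψ β θ : ℝ) (η : ℕ → ℝ) : Prop :=
  ∃ σ : ℝ, 0 < σ ∧ ∀ s : ℂ, σ < s.re →
    Summable (fun i => ‖laplaceTerm β θ η s i‖) ∧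
    laplace f s = (Ψ : ℂ) * ∑' i, laplaceTerm β θ η s i

/-- The growth condition `|η_i| r^i / Γ(iθ + ε) → 0` for some `ε > 0` and every `r > 0`: the
coefficients may tend to infinity, but more slowly than `Γ(iθ + ε)`, on the exponential scale. -/
def GrowthCondition (θ : ℝ) (η : ℕ → ℝ) : Prop :=
  ∃ ε : ℝ, 0 < ε ∧ ∀ r : ℝ, 0 < r →
    Tendsto (fun i : ℕ => |η i| * r ^ i / Real.Gamma ((i : ℝ) * θ + ε)) atTop (𝓝 0)

/-- The Borel transform of the formal series `∑ η_i s^{-β - iθ}`, obtained by replacing each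
`s^{-k}` by `x^{k-1} / Γ(k)`, the function whose Laplace transform is `s^{-k}`. -/
def borelTransform (β θ : ℝ) (η : ℕ → ℝ) (x : ℝ) : ℝ :=
  ∑' i : ℕ, η i * x ^ (-1 + θ * (i : ℝ) + β) / Real.Gamma ((i : ℝ) * θ + β)

/-- Divergent case: the series `∑ η_i s^{-β - iθ}` need not converge anywhere; its coefficients
satisfy the growth condition, and the Laplace transform of `f` is `Ψ` times the Borel sum
`∫₀^∞ e^{-s x} (∑ η_i x^{β + iθ - 1} / Γ(β + iθ)) dx` of the series on some right half-plane. -/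
def HasBorelForm (f : ℝ → ℝ) (Ψ β θ : ℝ) (η : ℕ → ℝ) : Prop :=
  GrowthCondition θ η ∧
  ∃ σ : ℝ, 0 < σ ∧ ∀ s : ℂ, σ < s.re →
    IntegrableOn (fun x : ℝ => Complex.exp (-s * (x : ℂ)) * (borelTransform β θ η x : ℂ))
      (Set.Ioi 0) ∧
    laplace f s = (Ψ : ℂ) * laplace (borelTransform β θ η) s

/-- The Laplace transform of `f` has the form `Ψ ∑ η_i s^{-β - iθ}`, the series being either
absolutely convergent or divergent and understood as a Borel sum. -/
def HasLaplaceForm (f : ℝ → ℝ) (Ψ β θ : ℝ) (η : ℕ → ℝ) : Prop :=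
  HasConvergentForm f Ψ β θ η ∨ HasBorelForm f Ψ β θ η

/-- The coefficients `δ_0 = η_0 ^ L`,
`δ_i = (1 / (i η_0)) ∑_{h = 1}^{i} δ_{i-h} η_h (h L + h - i)` for `i ≥ 1`
(below `i = n + 1` and `h = k + 1`; see `delta_recurrence` for the recurrence as displayed). -/
def delta (η : ℕ → ℝ) (L : ℕ) : ℕ → ℝ
  | 0 => η 0 ^ L
  | n + 1 => 1 / (((n : ℝ) + 1) * η 0) * ∑ k : Fin (n + 1),
      delta η L (n - k.val) * η (k.val + 1) *
        (((k.val : ℝ) + 1) * (L : ℝ) + ((k.val : ℝ) + 1) - ((n : ℝ) + 1))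
termination_by n => n

theorem delta_zero (η : ℕ → ℝ) (L : ℕ) : delta η L 0 = η 0 ^ L := by
  rw [delta]

theorem delta_recurrence (η : ℕ → ℝ) (L i : ℕ) (hi : 1 ≤ i) :
    delta η L i = 1 / ((i : ℝ) * η 0) * ∑ h ∈ Finset.Icc 1 i,
      delta η L (i - h) * η h * ((h : ℝ) * (L : ℝ) + (h : ℝ) - (i : ℝ)) := by
  obtain ⟨n, rfl⟩ : ∃ n, i = n + 1 := ⟨i - 1, by omega⟩
  rw [delta, ← Finset.sum_range (fun k => delta η L (n - k) * η (k + 1) *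
        (((k : ℝ) + 1) * (L : ℝ) + ((k : ℝ) + 1) - ((n : ℝ) + 1)))]
  rw [← Finset.Ico_succ_right_eq_Icc, Finset.sum_Ico_eq_sum_range]
  simp only [Nat.cast_add, Nat.cast_one]
  congr 1
  apply Finset.sum_congr (by simp)
  intro k hk
  rw [show n + 1 - (1 + k) = n - k by omega, add_comm 1 k, add_comm (1 : ℝ) (k : ℝ)]

end LaplaceSum

end

/-!
By Lerch's theorem a density with Laplace transform `Ψ ∑ η_i s^(-β - iθ)` is `Ψ` times the Borel
transform of that series, that is, a series of Riemann–Liouville kernels `x^(p-1) / Γ(p)` with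
`p = β + iθ`. These kernels form a convolution semigroup in `p`, so convolving two such densities
multiplies the formal power series of their coefficients: the coefficients for the sum of the `X_l`
are those of `(∑ η_i z^i)^L`, which Euler's recurrence for powers of a power series identifies as
the `δ_i`. The distribution function comes from one more convolution, with the constant `1`.

The convergent case reduces to the Borel one: absolute convergence at a single real `s` gives, by
Tonelli, absolute convergence of the series of kernels for almost every `x`, hence for every `x`
because quotients of kernels are monotone.
-/

namespace LaplaceSum

section PowerSeries

open PowerSeries

theorem coeff_X_mul_derivative {R : Type*} [CommSemiring R] (p : R⟦X⟧) (n : ℕ) :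
    coeff n (X * derivative R p) = n * coeff n p := by
  cases n with
  | zero => simp
  | succ n => rw [coeff_succ_X_mul, coeff_derivative, Nat.cast_succ, mul_comm]

theorem mul_derivative_pow {R : Type*} [CommSemiring R] (p : R⟦X⟧) (L : ℕ) :
    p * derivative R (p ^ L) = (L : R⟦X⟧) * (derivative R p * p ^ L) := by
  cases L with
  | zero => simp
  | succ L =>
    rw [Derivation.leibniz_pow, Nat.add_sub_cancel, nsmul_eq_mul, smul_eq_mul]
    ring

/-- This is the coefficient of `X ^ n` in `p * (X * d(p ^ L)/dX) = L * (X * dp/dX) * p ^ L`. -/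
theorem sum_antidiagonal_coeff_mul_coeff_pow {R : Type*} [CommRing R] (p : R⟦X⟧) (L n : ℕ) :
    ∑ z ∈ Finset.HasAntidiagonal.antidiagonal n,
      coeff z.2 (p ^ L) * coeff z.1 p * ((z.1 : R) * L - z.2) = 0 := by
  have hode : p * (X * derivative R (p ^ L)) = C (L : R) * ((X * derivative R p) * p ^ L) := by
    rw [map_natCast]
    linear_combination X * mul_derivative_pow p L
  have hcoeff := congrArg (coeff n) hode
  rw [coeff_C_mul, coeff_mul, coeff_mul, Finset.mul_sum, ← sub_eq_zero,
    ← Finset.sum_sub_distrib] at hcoeff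
  simp only [coeff_X_mul_derivative] at hcoeff
  rw [← neg_eq_zero, ← hcoeff, ← Finset.sum_neg_distrib]
  exact Finset.sum_congr rfl fun z _ => by ring

theorem natCast_mul_coeff_zero_mul_coeff_pow {R : Type*} [CommRing R] (p : R⟦X⟧) (L n : ℕ) :
    n * coeff 0 p * coeff n (p ^ L) = ∑ h ∈ Finset.Icc 1 n,
      coeff (n - h) (p ^ L) * coeff h p * ((h : R) * L + h - n) := by
  have hsum := sum_antidiagonal_coeff_mul_coeff_pow p L n
  rw [Finset.Nat.sum_antidiagonal_eq_sum_range_succ_mk, Finset.range_eq_Ico,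
    Finset.sum_eq_sum_Ico_succ_bot n.succ_pos, Nat.succ_eq_add_one,
    Finset.Ico_add_one_right_eq_Icc] at hsum
  simp only [Nat.cast_zero, zero_mul, zero_sub, Nat.sub_zero, zero_add] at hsum
  rw [show n * coeff 0 p * coeff n (p ^ L) = -(coeff n (p ^ L) * coeff 0 p * -(n : R)) by ring,
    neg_eq_of_add_eq_zero_right hsum]
  refine Finset.sum_congr rfl fun h hh => ?_
  rw [Nat.cast_sub (Finset.mem_Icc.1 hh).2]
  ring

theorem mk_delta {η : ℕ → ℝ} (hη : η 0 ≠ 0) (L : ℕ) : mk (delta η L) = mk η ^ L := by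
  ext n
  rw [coeff_mk]
  induction n using Nat.strong_induction_on with
  | _ n ih =>
    rcases n.eq_zero_or_pos with rfl | hn
    · simp [delta_zero]
    · have hnη : (n : ℝ) * η 0 ≠ 0 := mul_ne_zero (Nat.cast_ne_zero.2 hn.ne') hη
      have hEuler := natCast_mul_coeff_zero_mul_coeff_pow (mk η) L n
      simp only [coeff_mk] at hEuler
      rw [delta_recurrence η L n hn, one_div_mul_eq_div, div_eq_iff hnη, mul_comm _ (_ * _), hEuler]
      refine Finset.sum_congr rfl fun h hh => ?_
      have hh := Finset.mem_Icc.1 hh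
      rw [ih (n - h) (by lia)]

end PowerSeries

section Uniqueness

/-- The complex moment generating functions agree on a vertical strip around the imaginary axis by
the identity theorem, and on the axis itself they are the characteristic functions. -/
theorem measure_eq_of_mgf_eventuallyEq {μ ν : Measure ℝ} [IsFiniteMeasure μ] [IsFiniteMeasure ν]
    (hμ : ∀ᶠ t in 𝓝 0, Integrable (fun x => Real.exp (t * x)) μ)
    (hν : ∀ᶠ t in 𝓝 0, Integrable (fun x => Real.exp (t * x)) ν)
    (hmgf : mgf id μ =ᶠ[𝓝 0] mgf id ν) : μ = ν := by
  have hμ0 : (0 : ℝ) ∈ interior (integrableExpSet id μ) := mem_interior_iff_mem_nhds.2 hμ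
  have hν0 : (0 : ℝ) ∈ interior (integrableExpSet id ν) := mem_interior_iff_mem_nhds.2 hν
  have hfreq : ∃ᶠ z in 𝓝[≠] (0 : ℂ), complexMGF id μ z = complexMGF id ν z := by
    have hofReal : Tendsto ((↑) : ℝ → ℂ) (𝓝[≠] 0) (𝓝[≠] 0) :=
      Complex.continuous_ofReal.continuousWithinAt.tendsto_nhdsWithin fun x hx => by simpa using hx
    refine hofReal.frequently (Eventually.frequently ?_)
    filter_upwards [nhdsWithin_le_nhds hmgf] with x hx
    rw [complexMGF_ofReal, complexMGF_ofReal, hx]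
  have hstrip : Set.EqOn (complexMGF id μ) (complexMGF id ν)
      {z | z.re ∈ interior (integrableExpSet id μ) ∩ interior (integrableExpSet id ν)} :=
    AnalyticOnNhd.eqOn_of_preconnected_of_frequently_eq
      (analyticOnNhd_complexMGF.mono fun _ hz => hz.1)
      (analyticOnNhd_complexMGF.mono fun _ hz => hz.2)
      ((convex_integrableExpSet.interior.inter convex_integrableExpSet.interior).linear_preimage
        Complex.reLm).isPreconnected ⟨by simpa using hμ0, by simpa using hν0⟩ hfreq
  refine Measure.ext_of_charFun (funext fun t => ?_)
  rw [← complexMGF_id_mul_I, ← complexMGF_id_mul_I]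
  exact hstrip ⟨by simpa using hμ0, by simpa using hν0⟩

variable {μ : Measure ℝ} {k : ℝ → ℝ} {t : ℝ}

theorem integrable_max_zero_mul_exp (hk : AEStronglyMeasurable k μ)
    (ht : Integrable (fun x => Real.exp (t * x) * k x) μ) :
    Integrable (fun x => max (k x) 0 * Real.exp (t * x)) μ := by
  refine ht.mono ((hk.sup aestronglyMeasurable_const).mul (by fun_prop)) (ae_of_all _ fun x => ?_)
  rw [norm_mul, norm_mul, mul_comm]
  gcongr
  rw [Real.norm_of_nonneg (le_max_right _ _)]
  exact max_le (le_abs_self _) (abs_nonneg _)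

theorem integrable_exp_withDensity_ofReal (hk : AEStronglyMeasurable k μ)
    (ht : Integrable (fun x => Real.exp (t * x) * k x) μ) :
    Integrable (fun x => Real.exp (t * x)) (μ.withDensity fun x => ENNReal.ofReal (k x)) := by
  rw [integrable_withDensity_iff_integrable_smul₀' hk.aemeasurable.ennreal_ofReal (by simp)]
  simpa only [ENNReal.toReal_ofReal', smul_eq_mul] using integrable_max_zero_mul_exp hk ht

theorem mgf_withDensity_ofReal (hk : AEMeasurable k μ) :
    mgf id (μ.withDensity fun x => ENNReal.ofReal (k x)) t =
      ∫ x, max (k x) 0 * Real.exp (t * x) ∂μ := by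
  rw [mgf, integral_withDensity_eq_integral_toReal_smul₀ hk.ennreal_ofReal (by simp)]
  simp only [ENNReal.toReal_ofReal', smul_eq_mul, id]

theorem ae_eq_zero_of_integral_exp_mul_eq_zero (hk : Integrable k μ)
    (hint : ∀ᶠ t in 𝓝 0, Integrable (fun x => Real.exp (t * x) * k x) μ)
    (hzero : ∀ᶠ t in 𝓝 0, ∫ x, Real.exp (t * x) * k x ∂μ = 0) : k =ᵐ[μ] 0 := by
  have hint_neg : ∀ᶠ t in 𝓝 0, Integrable (fun x => Real.exp (t * x) * (-k) x) μ :=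
    hint.mono fun t ht => by
      simp only [Pi.neg_apply, mul_neg]
      exact ht.neg
  have := isFiniteMeasure_withDensity_ofReal hk.2
  have := isFiniteMeasure_withDensity_ofReal hk.neg.2
  have hjordan : μ.withDensity (fun x => ENNReal.ofReal (k x)) =
      μ.withDensity fun x => ENNReal.ofReal ((-k) x) := by
    refine measure_eq_of_mgf_eventuallyEq
      (hint.mono fun t => integrable_exp_withDensity_ofReal hk.1)
      (hint_neg.mono fun t => integrable_exp_withDensity_ofReal hk.neg.1) ?_
    filter_upwards [hint, hint_neg, hzero] with t ht ht_neg h0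
    rw [mgf_withDensity_ofReal hk.1.aemeasurable, mgf_withDensity_ofReal hk.neg.1.aemeasurable,
      ← sub_eq_zero, ← integral_sub (integrable_max_zero_mul_exp hk.1 ht)
        (integrable_max_zero_mul_exp hk.neg.1 ht_neg)]
    refine Eq.trans (integral_congr_ae (ae_of_all _ fun x => ?_)) h0
    beta_reduce
    rw [← sub_mul, Pi.neg_apply, max_zero_sub_max_neg_zero_eq_self, mul_comm]
  rw [withDensity_eq_iff hk.1.aemeasurable.ennreal_ofReal hk.neg.1.aemeasurable.ennreal_ofReal
    hk.lintegral_lt_top.ne] at hjordan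
  filter_upwards [hjordan] with x hx
  have hmax : max (k x) 0 = max (-k x) 0 := by
    simpa only [ENNReal.toReal_ofReal', Pi.neg_apply] using congrArg ENNReal.toReal hx
  rw [Pi.zero_apply, ← max_zero_sub_max_neg_zero_eq_self (k x), hmax, sub_self]

/-- Lerch's theorem, for Laplace transforms known on a real half-line only. -/
theorem ae_eq_zero_of_integral_exp_neg_mul_eq_zero {h : ℝ → ℝ} {σ : ℝ}
    (hint : ∀ s, σ < s → Integrable (fun x => Real.exp (-s * x) * h x) μ)
    (hzero : ∀ s, σ < s → ∫ x, Real.exp (-s * x) * h x ∂μ = 0) : h =ᵐ[μ] 0 := by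
  have hshift : ∀ t, (fun x => Real.exp (t * x) * (Real.exp (-(σ + 1) * x) * h x)) =
      fun x => Real.exp (-(σ + 1 - t) * x) * h x := by
    intro t
    ext x
    rw [← mul_assoc, ← Real.exp_add]
    ring_nf
  have hnear : ∀ᶠ t in 𝓝 (0 : ℝ), σ < σ + 1 - t :=
    (eventually_lt_nhds zero_lt_one).mono fun t ht => by linarith
  have hk := ae_eq_zero_of_integral_exp_mul_eq_zero (hint (σ + 1) (by linarith))
    (hnear.mono fun t ht => (hshift t).symm ▸ hint _ ht)
    (hnear.mono fun t ht => (hshift t).symm ▸ hzero _ ht)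
  filter_upwards [hk] with x hx
  simpa [Real.exp_ne_zero] using hx

end Uniqueness

section Tsum

variable {α ι : Type*} [MeasurableSpace α] {μ : Measure α}

theorem summable_integral_norm_const_mul {c : ι → ℝ} {g : ι → α → ℝ} (hg : ∀ i, 0 ≤ᵐ[μ] g i)
    (hsum : Summable fun i => c i * ∫ a, g i a ∂μ) :
    Summable fun i => ∫ a, ‖c i * g i a‖ ∂μ := by
  refine hsum.norm.congr fun i => ?_
  rw [norm_mul, Real.norm_of_nonneg (integral_nonneg_of_ae (hg i)), ← integral_const_mul]
  refine integral_congr_ae ((hg i).mono fun a ha => ?_)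
  beta_reduce
  rw [norm_mul, Real.norm_of_nonneg ha]

variable {E : Type*} [NormedAddCommGroup E] [Countable ι] {F : ι → α → E}

theorem lintegral_tsum_enorm_lt_top (hF : ∀ i, Integrable (F i) μ)
    (hsum : Summable fun i => ∫ a, ‖F i a‖ ∂μ) : ∫⁻ a, ∑' i, ‖F i a‖ₑ ∂μ < ⊤ := by
  rw [lintegral_tsum fun i => (hF i).1.enorm]
  simp_rw [← ofReal_integral_norm_eq_lintegral_enorm (hF _)]
  exact hsum.tsum_ofReal_lt_top

theorem ae_summable_norm_of_summable_integral_norm (hF : ∀ i, Integrable (F i) μ)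
    (hsum : Summable fun i => ∫ a, ‖F i a‖ ∂μ) : ∀ᵐ a ∂μ, Summable fun i => ‖F i a‖ := by
  have hmeas : AEMeasurable (fun a => ∑' i, ‖F i a‖ₑ) μ :=
    AEMeasurable.tsum fun i => (hF i).1.enorm
  filter_upwards [ae_lt_top' hmeas (lintegral_tsum_enorm_lt_top hF hsum).ne] with a ha
  exact NNReal.summable_coe.2 (ENNReal.tsum_coe_ne_top_iff_summable.1 ha.ne)

theorem integrable_tsum_of_summable_integral_norm [CompleteSpace E]
    (hF : ∀ i, Integrable (F i) μ) (hsum : Summable fun i => ∫ a, ‖F i a‖ ∂μ) :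
    Integrable (fun a => ∑' i, F i a) μ := by
  refine ⟨aestronglyMeasurable_of_tendsto_ae (u := atTop)
    (f := fun (s : Finset ι) a => ∑ i ∈ s, F i a)
    (fun s => (integrable_finsetSum s fun i _ => hF i).1) ?_, ?_⟩
  · filter_upwards [ae_summable_norm_of_summable_integral_norm hF hsum] with a ha
    exact ha.of_norm.hasSum
  · exact (lintegral_mono fun a => enorm_tsum_le_tsum_enorm).trans_lt
      (lintegral_tsum_enorm_lt_top hF hsum)

end Tsum

/-- The Riemann–Liouville kernel `x ^ (p - 1) / Γ(p)`, whose Laplace transform is `s ^ (-p)`. These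
kernels form a convolution semigroup in `p`, and Borel transforms are series in them. -/
noncomputable def gammaKernel (p x : ℝ) : ℝ := x ^ (p - 1) / Real.Gamma p

section GammaKernel

variable {p q p' q' x y s : ℝ}

theorem gammaKernel_one (x : ℝ) : gammaKernel 1 x = 1 := by simp [gammaKernel]

theorem gammaKernel_zero_right (hp : p ≠ 1) : gammaKernel p 0 = 0 := by
  rw [gammaKernel, Real.zero_rpow (sub_ne_zero.2 hp), zero_div]

theorem gammaKernel_nonneg (hp : 0 < p) (hx : 0 ≤ x) : 0 ≤ gammaKernel p x :=
  div_nonneg (Real.rpow_nonneg hx _) (Real.Gamma_pos_of_pos hp).le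

theorem gammaKernel_pos (hp : 0 < p) (hx : 0 < x) : 0 < gammaKernel p x :=
  div_pos (Real.rpow_pos_of_pos hx _) (Real.Gamma_pos_of_pos hp)

theorem continuousOn_gammaKernel (p : ℝ) : ContinuousOn (gammaKernel p) (Set.Ioi 0) :=
  (continuousOn_id.rpow_const fun _ hx => Or.inl (ne_of_gt hx)).div_const _

/-- The quotient of the kernels of exponents `q` and `p` is a multiple of `x ^ (q - p)`, hence
monotone. -/
theorem gammaKernel_le_mul_div (hp : 0 < p) (hpq : p ≤ q) (hx : 0 < x) (hxy : x ≤ y) :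
    gammaKernel q x ≤ gammaKernel p x * (gammaKernel q y / gammaKernel p y) := by
  have hquot : ∀ {z}, 0 < z →
      gammaKernel q z / gammaKernel p z = Real.Gamma p / Real.Gamma q * z ^ (q - p) := by
    intro z hz
    rw [gammaKernel, gammaKernel, show q - p = (q - 1) - (p - 1) by ring,
      Real.rpow_sub hz (q - 1), div_div_div_eq, div_mul_div_comm]
    ring
  have := Real.Gamma_pos_of_pos hp
  have hΓq := Real.Gamma_pos_of_pos (hp.trans_le hpq)
  rw [← div_le_iff₀' (gammaKernel_pos hp hx), hquot hx, hquot (hx.trans_le hxy)]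
  gcongr

theorem integral_rpow_mul_sub_rpow (hp : 0 < p) (hq : 0 < q) (hx : 0 < x) :
    ∫ y in Set.Ioo 0 x, y ^ (p - 1) * (x - y) ^ (q - 1) =
      x ^ (p + q - 1) * (Real.Gamma p * Real.Gamma q / Real.Gamma (p + q)) := by
  have hbeta := Complex.betaIntegral_scaled p q hx
  rw [Complex.betaIntegral_eq_Gamma_mul_div _ _ (by simpa) (by simpa),
    intervalIntegral.integral_of_le hx.le, integral_Ioc_eq_integral_Ioo] at hbeta
  rw [← Complex.ofReal_inj, ← integral_complex_ofReal]
  refine Eq.trans ?_ (hbeta.trans ?_)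
  · refine setIntegral_congr_fun measurableSet_Ioo fun y hy => ?_
    push_cast [Complex.ofReal_cpow hy.1.le, Complex.ofReal_cpow (sub_nonneg.2 hy.2.le)]
    rfl
  · push_cast [Complex.ofReal_cpow hx.le, ← Complex.Gamma_ofReal]
    rfl

theorem integral_gammaKernel_mul (hp : 0 < p) (hq : 0 < q) (hx : 0 < x) :
    ∫ y in Set.Ioo 0 x, gammaKernel p y * gammaKernel q (x - y) = gammaKernel (p + q) x := by
  have hΓp := Real.Gamma_pos_of_pos hp
  have hΓq := Real.Gamma_pos_of_pos hq
  simp only [gammaKernel, div_mul_div_comm]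
  rw [integral_div, integral_rpow_mul_sub_rpow hp hq hx, mul_div_assoc, div_right_comm,
    div_self (mul_pos hΓp hΓq).ne', mul_one_div]

theorem integrableOn_gammaKernel_mul (hp : 0 < p) (hq : 0 < q) (hx : 0 < x) :
    IntegrableOn (fun y => gammaKernel p y * gammaKernel q (x - y)) (Set.Ioo 0 x) :=
  Integrable.of_integral_ne_zero
    (integral_gammaKernel_mul hp hq hx ▸ (gammaKernel_pos (add_pos hp hq) hx).ne')

theorem gammaKernel_add_le_mul_div (hp : 0 < p) (hq : 0 < q) (hpp' : p ≤ p') (hqq' : q ≤ q')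
    (hx : 0 < x) : gammaKernel (p' + q') x ≤ gammaKernel (p + q) x *
      (gammaKernel p' x / gammaKernel p x * (gammaKernel q' x / gammaKernel q x)) := by
  have hp' := hp.trans_le hpp'
  have hq' := hq.trans_le hqq'
  rw [← integral_gammaKernel_mul hp' hq' hx, ← integral_gammaKernel_mul hp hq hx,
    ← integral_mul_const]
  refine setIntegral_mono_on (integrableOn_gammaKernel_mul hp' hq' hx)
    ((integrableOn_gammaKernel_mul hp hq hx).mul_const _) measurableSet_Ioo fun y hy => ?_
  have hxy : 0 < x - y := sub_pos.2 hy.2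
  rw [mul_mul_mul_comm]
  exact mul_le_mul (gammaKernel_le_mul_div hp hpp' hy.1 hy.2.le)
    (gammaKernel_le_mul_div hq hqq' hxy (sub_le_self x hy.1.le)) (gammaKernel_nonneg hq' hxy.le)
    (mul_nonneg (gammaKernel_nonneg hp hy.1.le)
      (div_nonneg (gammaKernel_nonneg hp' hx.le) (gammaKernel_nonneg hp hx.le)))

theorem integral_exp_mul_gammaKernel (hp : 0 < p) (hs : 0 < s) :
    ∫ x in Set.Ioi 0, Real.exp (-s * x) * gammaKernel p x = s ^ (-p) := by
  have hΓ := Real.Gamma_pos_of_pos hp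
  have hcomm : ∀ x, Real.exp (-s * x) * gammaKernel p x =
      x ^ (p - 1) * Real.exp (-(s * x)) / Real.Gamma p := fun x => by
    rw [gammaKernel, neg_mul, mul_comm, div_mul_eq_mul_div]
  simp only [hcomm]
  rw [integral_div, Real.integral_rpow_mul_exp_neg_mul_Ioi hp hs, one_div, Real.inv_rpow hs.le,
    Real.rpow_neg hs.le, mul_div_cancel_right₀ _ hΓ.ne']

theorem integrableOn_exp_mul_gammaKernel (hp : 0 < p) (hs : 0 < s) :
    IntegrableOn (fun x => Real.exp (-s * x) * gammaKernel p x) (Set.Ioi 0) :=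
  Integrable.of_integral_ne_zero
    (integral_exp_mul_gammaKernel hp hs ▸ (Real.rpow_pos_of_pos hs _).ne')

end GammaKernel

/-- Absolute convergence on `(0, ∞)` of the series of kernels defining `borelTransform α θ a`. -/
def BorelSummable (α θ : ℝ) (a : ℕ → ℝ) : Prop :=
  ∀ x : ℝ, 0 < x → Summable fun i : ℕ => a i * gammaKernel (i * θ + α) x

section BorelTransform

variable {α θ : ℝ} {a : ℕ → ℝ} {x y : ℝ}

theorem borelTransform_term (α θ : ℝ) (a : ℕ → ℝ) (x : ℝ) (i : ℕ) :
    a i * x ^ (-1 + θ * (i : ℝ) + α) / Real.Gamma ((i : ℝ) * θ + α) =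
      a i * gammaKernel (i * θ + α) x := by
  rw [gammaKernel, mul_div_assoc, show -1 + θ * (i : ℝ) + α = i * θ + α - 1 by ring]

theorem borelTransform_eq (α θ : ℝ) (a : ℕ → ℝ) (x : ℝ) :
    borelTransform α θ a x = ∑' i : ℕ, a i * gammaKernel (i * θ + α) x := by
  simp only [borelTransform, borelTransform_term]

theorem norm_mul_gammaKernel_le (hα : 0 < α) (hθ : 0 ≤ θ) (hx : 0 < x) (hxy : x ≤ y) (i : ℕ) :
    ‖a i * gammaKernel (i * θ + α) x‖ ≤
      gammaKernel α x * (‖a i * gammaKernel (i * θ + α) y‖ / gammaKernel α y) := by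
  rw [norm_mul, norm_mul, Real.norm_of_nonneg (gammaKernel_nonneg (by positivity) hx.le),
    Real.norm_of_nonneg (gammaKernel_nonneg (by positivity) (hx.le.trans hxy)), mul_div_assoc,
    mul_left_comm]
  gcongr
  exact gammaKernel_le_mul_div hα (le_add_of_nonneg_left (by positivity)) hx hxy

theorem summable_mul_gammaKernel_of_le (hα : 0 < α) (hθ : 0 ≤ θ) (hx : 0 < x) (hxy : x ≤ y)
    (h : Summable fun i : ℕ => a i * gammaKernel (i * θ + α) y) :
    Summable fun i : ℕ => a i * gammaKernel (i * θ + α) x :=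
  ((h.norm.div_const _).mul_left _).of_norm_bounded (norm_mul_gammaKernel_le hα hθ hx hxy)

theorem continuousOn_borelTransform (hα : 0 < α) (hθ : 0 ≤ θ) (h : BorelSummable α θ a) :
    ContinuousOn (borelTransform α θ a) (Set.Ioi 0) := by
  intro x hx
  have hx : 0 < x := hx
  have hpos : Set.Icc (x / 2) (2 * x) ⊆ Set.Ioi 0 := fun y hy => (half_pos hx).trans_le hy.1
  obtain ⟨C, hC⟩ := isCompact_Icc.exists_bound_of_continuousOn
    ((continuousOn_gammaKernel α).mono hpos)
  have hcont : ContinuousOn (borelTransform α θ a) (Set.Icc (x / 2) (2 * x)) := by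
    simp only [funext (borelTransform_eq α θ a)]
    refine continuousOn_tsum
      (fun i => ((continuousOn_gammaKernel _).mono hpos).const_mul _ |>.congr fun y _ => rfl)
      (((h (2 * x) (by positivity)).norm.div_const (gammaKernel α (2 * x))).mul_left C)
      fun i y hy => (norm_mul_gammaKernel_le hα hθ (hpos hy) hy.2 i).trans ?_
    have hK := gammaKernel_pos hα (x := 2 * x) (by positivity)
    gcongr
    exact (le_abs_self _).trans (hC y hy)
  exact (hcont.continuousAt
    (Icc_mem_nhds (by linarith) (by linarith))).continuousWithinAt

theorem Gamma_add_nat_le {y : ℝ} (hy : 0 < y) (n : ℕ) :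
    Real.Gamma (y + n) ≤ Real.Gamma y * (y + n) ^ n := by
  have := Real.Gamma_pos_of_pos hy
  induction n with
  | zero => simp
  | succ n ih =>
    have hyn : 0 < y + n := by positivity
    rw [Nat.cast_succ, ← add_assoc, Real.Gamma_add_one hyn.ne', pow_succ', mul_left_comm]
    have hle : y + n ≤ y + n + 1 := le_add_of_nonneg_right zero_le_one
    calc (y + n) * Real.Gamma (y + n) ≤ (y + n) * (Real.Gamma y * (y + n) ^ n) := by gcongr
      _ ≤ (y + n + 1) * (Real.Gamma y * (y + n + 1) ^ n) := by gcongr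

theorem exists_isBigO_Gamma_natCast_mul_add (hα : 0 < α) (hθ : 0 < θ) (ε : ℝ) :
    ∃ n : ℕ, (fun i : ℕ => Real.Gamma (i * θ + ε)) =O[atTop]
      fun i : ℕ => (i : ℝ) ^ n * Real.Gamma (i * θ + α) := by
  obtain ⟨n, hn⟩ := exists_nat_ge (ε - α)
  have hlarge : ∀ᶠ i : ℕ in atTop, 2 ≤ (i : ℝ) * θ + ε :=
    (tendsto_atTop_add_const_right _ ε
      (tendsto_natCast_atTop_atTop.atTop_mul_const hθ)).eventually_ge_atTop 2
  refine ⟨n, Asymptotics.IsBigO.of_bound ((θ + α + n) ^ n) ?_⟩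
  filter_upwards [hlarge, eventually_ge_atTop 1] with i hi2 hi1
  have hi1 : (1 : ℝ) ≤ i := by exact_mod_cast hi1
  have : 0 < Real.Gamma (i * θ + α) := Real.Gamma_pos_of_pos (by positivity)
  have hΓε : 0 < Real.Gamma (i * θ + ε) := Real.Gamma_pos_of_pos (by linarith)
  have hbase : i * θ + α + n ≤ (θ + α + n) * i := by
    nlinarith [mul_nonneg (sub_nonneg.2 hi1) (add_nonneg hα.le (Nat.cast_nonneg (α := ℝ) n))]
  rw [Real.norm_of_nonneg hΓε.le, Real.norm_of_nonneg (by positivity)]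
  calc Real.Gamma (i * θ + ε) ≤ Real.Gamma (i * θ + α + n) :=
        Real.Gamma_strictMonoOn_Ici.monotoneOn hi2
          (hi2.trans (by linarith) : 2 ≤ i * θ + α + n) (by linarith)
    _ ≤ Real.Gamma (i * θ + α) * (i * θ + α + n) ^ n := Gamma_add_nat_le (by positivity) n
    _ ≤ Real.Gamma (i * θ + α) * ((θ + α + n) * i) ^ n := by gcongr
    _ = (θ + α + n) ^ n * (i ^ n * Real.Gamma (i * θ + α)) := by rw [mul_pow]; ring

theorem GrowthCondition.borelSummable (hα : 0 < α) (hθ : 0 < θ) (h : GrowthCondition θ a) :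
    BorelSummable α θ a := by
  intro x hx
  obtain ⟨ε, hε, hlim⟩ := h
  obtain ⟨n, hn⟩ := exists_isBigO_Gamma_natCast_mul_add hα hθ ε
  have hgrowth : (fun i : ℕ => |a i| * (2 * x ^ θ) ^ i) =O[atTop]
      fun i : ℕ => Real.Gamma (i * θ + ε) := by
    refine (Asymptotics.isLittleO_of_tendsto (fun i hi => ?_) (hlim _ (by positivity))).isBigO
    exact absurd hi (Real.Gamma_pos_of_pos (by positivity)).ne'
  have hterm : ∀ i : ℕ, ‖a i * gammaKernel (i * θ + α) x‖ = |a i| * (2 * x ^ θ) ^ i *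
      (x ^ (α - 1) * (1 / 2) ^ i / Real.Gamma (i * θ + α)) := by
    intro i
    have hpow : (x ^ θ) ^ i = (2 * x ^ θ) ^ i * (1 / 2) ^ i := by
      rw [← mul_pow, mul_right_comm, mul_one_div_cancel two_ne_zero, one_mul]
    rw [norm_mul, Real.norm_eq_abs,
      Real.norm_of_nonneg (gammaKernel_nonneg (by positivity) hx.le), gammaKernel,
      show i * θ + α - 1 = (α - 1) + θ * i by ring, Real.rpow_add hx, Real.rpow_mul hx.le,
      Real.rpow_natCast, hpow]
    ring
  refine Summable.of_norm (summable_of_isBigO_nat (g := fun i : ℕ => (i : ℝ) ^ n * (1 / 2) ^ i)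
    (summable_pow_mul_geometric_of_norm_lt_one n (by norm_num)) ?_)
  simp only [hterm]
  refine ((hgrowth.trans hn).mul (Asymptotics.isBigO_refl _ _)).trans
    (Asymptotics.IsBigO.of_bound (x ^ (α - 1)) (Eventually.of_forall fun i => le_of_eq ?_))
  have hΓ : 0 < Real.Gamma (i * θ + α) := Real.Gamma_pos_of_pos (by positivity)
  rw [Real.norm_of_nonneg (by positivity), Real.norm_of_nonneg (by positivity)]
  field_simp [hΓ.ne']

end BorelTransform

section Convolution

variable {α β θ : ℝ} {a b c : ℕ → ℝ} {x : ℝ}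

theorem summable_mul_gammaKernel_add (hα : 0 < α) (hβ : 0 < β) (hθ : 0 ≤ θ) (hx : 0 < x)
    (ha : Summable fun i : ℕ => a i * gammaKernel (i * θ + α) x)
    (hb : Summable fun i : ℕ => b i * gammaKernel (i * θ + β) x) :
    Summable fun z : ℕ × ℕ =>
      a z.1 * b z.2 * gammaKernel ((z.1 * θ + α) + (z.2 * θ + β)) x := by
  have hprod := (summable_mul_of_summable_norm ha.norm hb.norm).norm.mul_left
    (gammaKernel (α + β) x * (gammaKernel α x * gammaKernel β x)⁻¹)
  refine hprod.of_norm_bounded fun z => ?_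
  have hK := gammaKernel_add_le_mul_div hα hβ
    (le_add_of_nonneg_left (by positivity) : α ≤ z.1 * θ + α)
    (le_add_of_nonneg_left (by positivity) : β ≤ z.2 * θ + β) hx
  simp only [norm_mul]
  rw [Real.norm_of_nonneg (gammaKernel_nonneg (by positivity) hx.le),
    Real.norm_of_nonneg (gammaKernel_nonneg (by positivity) hx.le),
    Real.norm_of_nonneg (gammaKernel_nonneg (by positivity) hx.le)]
  refine (mul_le_mul_of_nonneg_left hK (by positivity)).trans_eq ?_
  rw [mul_inv]
  ring

theorem hasSum_mul_gammaKernel_of_hasSum_prod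
    (hc : PowerSeries.mk c = PowerSeries.mk a * PowerSeries.mk b) {v : ℝ}
    (h : HasSum (fun z : ℕ × ℕ =>
      a z.1 * b z.2 * gammaKernel ((z.1 * θ + α) + (z.2 * θ + β)) x) v) :
    HasSum (fun n : ℕ => c n * gammaKernel (n * θ + (α + β)) x) v := by
  rw [← (Finset.HasAntidiagonal.sigmaAntidiagonalEquivProd (A := ℕ)).hasSum_iff] at h
  refine (h.sigma fun n => hasSum_fintype _).congr_fun fun n => ?_
  have hcn := congrArg (PowerSeries.coeff n) hc
  rw [PowerSeries.coeff_mk, PowerSeries.coeff_mul] at hcn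
  rw [hcn, Finset.sum_mul, Finset.univ_eq_attach,
    ← Finset.sum_attach (Finset.HasAntidiagonal.antidiagonal n)]
  refine Finset.sum_congr rfl fun z _ => ?_
  have hz : (z.1.1 : ℝ) + z.1.2 = n := by
    exact_mod_cast Finset.HasAntidiagonal.mem_antidiagonal.1 z.2
  rw [PowerSeries.coeff_mk, PowerSeries.coeff_mk, ← hz,
    show ((z.1.1 : ℝ) + z.1.2) * θ + (α + β) = (z.1.1 * θ + α) + (z.1.2 * θ + β) by ring]
  rfl

theorem BorelSummable.mul (hα : 0 < α) (hβ : 0 < β) (hθ : 0 ≤ θ)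
    (hc : PowerSeries.mk c = PowerSeries.mk a * PowerSeries.mk b)
    (ha : BorelSummable α θ a) (hb : BorelSummable β θ b) : BorelSummable (α + β) θ c :=
  fun x hx => (hasSum_mul_gammaKernel_of_hasSum_prod hc
    (summable_mul_gammaKernel_add hα hβ hθ hx (ha x hx) (hb x hx)).hasSum).summable

theorem tsum_gammaKernel_mul_gammaKernel (ha : BorelSummable α θ a) (hb : BorelSummable β θ b)
    {y : ℝ} (hy : y ∈ Set.Ioo 0 x) :
    ∑' z : ℕ × ℕ, a z.1 * b z.2 *
      (gammaKernel (z.1 * θ + α) y * gammaKernel (z.2 * θ + β) (x - y)) =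
        borelTransform α θ a y * borelTransform β θ b (x - y) := by
  rw [borelTransform_eq, borelTransform_eq,
    tsum_mul_tsum_of_summable_norm (ha y hy.1).norm (hb (x - y) (sub_pos.2 hy.2)).norm]
  exact tsum_congr fun z => mul_mul_mul_comm _ _ _ _

theorem summable_integral_norm_gammaKernel_mul (hα : 0 < α) (hβ : 0 < β) (hθ : 0 ≤ θ)
    (hx : 0 < x) (ha : BorelSummable α θ a) (hb : BorelSummable β θ b) :
    Summable fun z : ℕ × ℕ => ∫ y in Set.Ioo 0 x, ‖a z.1 * b z.2 *
      (gammaKernel (z.1 * θ + α) y * gammaKernel (z.2 * θ + β) (x - y))‖ := by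
  refine summable_integral_norm_const_mul (fun z => ?_) ?_
  · filter_upwards [ae_restrict_mem measurableSet_Ioo] with y hy
    exact mul_nonneg (gammaKernel_nonneg (by positivity) hy.1.le)
      (gammaKernel_nonneg (by positivity) (sub_nonneg.2 hy.2.le))
  · simp (disch := positivity) only [integral_gammaKernel_mul]
    exact summable_mul_gammaKernel_add hα hβ hθ hx (ha x hx) (hb x hx)

theorem integrableOn_borelTransform_mul_borelTransform (hα : 0 < α) (hβ : 0 < β) (hθ : 0 ≤ θ)
    (ha : BorelSummable α θ a) (hb : BorelSummable β θ b) (hx : 0 < x) :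
    IntegrableOn (fun y => borelTransform α θ a y * borelTransform β θ b (x - y))
      (Set.Ioo 0 x) :=
  (integrable_tsum_of_summable_integral_norm
    (fun _ => (integrableOn_gammaKernel_mul (by positivity) (by positivity) hx).const_mul _)
    (summable_integral_norm_gammaKernel_mul hα hβ hθ hx ha hb)).congr
    ((ae_restrict_mem measurableSet_Ioo).mono fun _ => tsum_gammaKernel_mul_gammaKernel ha hb)

theorem integral_borelTransform_mul_borelTransform (hα : 0 < α) (hβ : 0 < β) (hθ : 0 ≤ θ)
    (hc : PowerSeries.mk c = PowerSeries.mk a * PowerSeries.mk b)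
    (ha : BorelSummable α θ a) (hb : BorelSummable β θ b) (hx : 0 < x) :
    ∫ y in Set.Ioo 0 x, borelTransform α θ a y * borelTransform β θ b (x - y) =
      borelTransform (α + β) θ c x := by
  have hsum := hasSum_integral_of_summable_integral_norm
    (fun _ => (integrableOn_gammaKernel_mul (by positivity) (by positivity) hx).const_mul _)
    (summable_integral_norm_gammaKernel_mul hα hβ hθ hx ha hb)
  simp (disch := positivity) only [integral_const_mul, integral_gammaKernel_mul] at hsum
  rw [borelTransform_eq, (hasSum_mul_gammaKernel_of_hasSum_prod hc hsum).tsum_eq]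
  exact setIntegral_congr_fun measurableSet_Ioo fun _ hy =>
    (tsum_gammaKernel_mul_gammaKernel ha hb hy).symm

theorem borelTransform_pi_single (θ x : ℝ) : borelTransform 1 θ (Pi.single 0 1) x = 1 := by
  rw [borelTransform_eq, tsum_eq_single 0 fun i hi => by simp [hi]]
  simp [gammaKernel_one]

theorem borelSummable_pi_single (α θ : ℝ) : BorelSummable α θ (Pi.single 0 1) :=
  fun _ _ => summable_of_ne_finset_zero (s := {0}) fun i hi => by
    simp [show i ≠ 0 by simpa using hi]

theorem mk_eq_mk_mul_mk_pi_single (a : ℕ → ℝ) :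
    PowerSeries.mk a = PowerSeries.mk a * PowerSeries.mk (Pi.single 0 1) := by
  have hone : PowerSeries.mk (Pi.single 0 1 : ℕ → ℝ) = 1 := by
    ext n
    rw [PowerSeries.coeff_mk, PowerSeries.coeff_one, Pi.single_apply]
  rw [hone, mul_one]

theorem borelTransform_zero_right (hα : 1 < α) (hθ : 0 ≤ θ) : borelTransform α θ a 0 = 0 := by
  rw [borelTransform_eq]
  refine (tsum_congr fun i => ?_).trans tsum_zero
  have hi : (i : ℝ) * θ + α ≠ 1 := (hα.trans_le (le_add_of_nonneg_left (by positivity))).ne'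
  rw [gammaKernel_zero_right hi, mul_zero]

/-- Integration is convolution with the constant `1`, the Borel transform of `s⁻¹`. -/
theorem integral_borelTransform (hα : 0 < α) (hθ : 0 ≤ θ) (ha : BorelSummable α θ a)
    (hx : 0 ≤ x) : ∫ y in Set.Ioo 0 x, borelTransform α θ a y = borelTransform (α + 1) θ a x := by
  obtain rfl | hx := hx.eq_or_lt
  · rw [Set.Ioo_self, setIntegral_empty,
      borelTransform_zero_right (lt_add_of_pos_left 1 hα) hθ]
  · simpa only [borelTransform_pi_single, mul_one] using
      integral_borelTransform_mul_borelTransform hα one_pos hθ (mk_eq_mk_mul_mk_pi_single a) ha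
        (borelSummable_pi_single 1 θ) hx

theorem BorelSummable.add_one (hα : 0 < α) (hθ : 0 ≤ θ) (ha : BorelSummable α θ a) :
    BorelSummable (α + 1) θ a :=
  ha.mul hα one_pos hθ (mk_eq_mk_mul_mk_pi_single a) (borelSummable_pi_single 1 θ)

theorem integrableOn_borelTransform (hα : 0 < α) (hθ : 0 ≤ θ) (ha : BorelSummable α θ a) (x : ℝ) :
    IntegrableOn (borelTransform α θ a) (Set.Ioo 0 x) := by
  rcases le_or_gt x 0 with hx | hx
  · rw [Set.Ioo_eq_empty hx.not_gt]
    exact integrableOn_empty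
  · simpa only [borelTransform_pi_single, mul_one] using
      integrableOn_borelTransform_mul_borelTransform hα one_pos hθ ha
        (borelSummable_pi_single 1 θ) hx

end Convolution

section Antiderivative

variable {α θ : ℝ} {a : ℕ → ℝ} {x : ℝ}

theorem borelTransform_add_one_term (α θ : ℝ) (a : ℕ → ℝ) (x : ℝ) (i : ℕ) :
    a i * x ^ (θ * (i : ℝ) + α) / Real.Gamma (1 + (i : ℝ) * θ + α) =
      a i * gammaKernel (i * θ + (α + 1)) x := by
  rw [gammaKernel, mul_div_assoc, show i * θ + (α + 1) - 1 = θ * (i : ℝ) + α by ring,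
    show i * θ + (α + 1) = 1 + (i : ℝ) * θ + α by ring]

theorem borelTransform_add_one_eq (α θ : ℝ) (a : ℕ → ℝ) (x : ℝ) : borelTransform (α + 1) θ a x =
    ∑' i : ℕ, a i * x ^ (θ * (i : ℝ) + α) / Real.Gamma (1 + (i : ℝ) * θ + α) := by
  simp only [borelTransform_eq, borelTransform_add_one_term]

theorem BorelSummable.summable_abs (h : BorelSummable α θ a) (hx : 0 < x) :
    Summable fun i : ℕ =>
      |a i * x ^ (-1 + θ * (i : ℝ) + α) / Real.Gamma ((i : ℝ) * θ + α)| := by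
  simp only [borelTransform_term]
  exact (h x hx).abs

theorem BorelSummable.summable_abs_add_one (hα : 0 < α) (hθ : 0 ≤ θ) (h : BorelSummable α θ a)
    (hx : 0 ≤ x) : Summable fun i : ℕ =>
      |a i * x ^ (θ * (i : ℝ) + α) / Real.Gamma (1 + (i : ℝ) * θ + α)| := by
  simp only [borelTransform_add_one_term]
  obtain rfl | hx := hx.eq_or_lt
  · refine summable_zero.congr fun i => ?_
    have hi : (i : ℝ) * θ + (α + 1) ≠ 1 :=
      (lt_add_of_nonneg_of_lt (by positivity) (lt_add_of_pos_left 1 hα)).ne'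
    rw [gammaKernel_zero_right hi, mul_zero, abs_zero]
  · exact (h.add_one hα hθ x hx).abs

end Antiderivative

/-- The real-variable content common to the two senses of `HasLaplaceForm`: on a half-line, the
Laplace transform of `f` is that of `Ψ` times the Borel transform of the series. -/
def HasRealBorelForm (f : ℝ → ℝ) (Ψ β θ : ℝ) (η : ℕ → ℝ) : Prop :=
  BorelSummable β θ η ∧ ∃ σ : ℝ, 0 < σ ∧ ∀ s : ℝ, σ < s →
    IntegrableOn (fun x => Real.exp (-s * x) * borelTransform β θ η x) (Set.Ioi 0) ∧
    ∫ x in Set.Ioi 0, Real.exp (-s * x) * f x =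
      Ψ * ∫ x in Set.Ioi 0, Real.exp (-s * x) * borelTransform β θ η x

section LaplaceTransform

variable {f : ℝ → ℝ} {Ψ β θ s : ℝ} {η : ℕ → ℝ}

theorem laplace_ofReal (f : ℝ → ℝ) (s : ℝ) :
    laplace f s = ((∫ x in Set.Ioi 0, Real.exp (-s * x) * f x : ℝ) : ℂ) := by
  rw [laplace, ← integral_complex_ofReal]
  push_cast
  rfl

theorem laplaceTerm_ofReal (β θ : ℝ) (η : ℕ → ℝ) (hs : 0 ≤ s) (i : ℕ) :
    laplaceTerm β θ η s i = ((η i * s ^ (-(i * θ + β)) : ℝ) : ℂ) := by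
  rw [laplaceTerm]
  push_cast [Complex.ofReal_cpow hs]
  ring_nf

theorem HasBorelForm.hasRealBorelForm (hβ : 0 < β) (hθ : 0 < θ) (h : HasBorelForm f Ψ β θ η) :
    HasRealBorelForm f Ψ β θ η := by
  obtain ⟨hgrowth, σ, hσ, hlaplace⟩ := h
  refine ⟨hgrowth.borelSummable hβ hθ, σ, hσ, fun s hs => ?_⟩
  obtain ⟨hint, heq⟩ := hlaplace s (by simpa using hs)
  constructor
  · refine hint.re.congr (ae_of_all _ fun x => ?_)
    beta_reduce
    rw [show (-(s : ℂ) * (x : ℂ)) = ((-s * x : ℝ) : ℂ) by push_cast; ring, ← Complex.ofReal_exp,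
      ← Complex.ofReal_mul, RCLike.re_to_complex, Complex.ofReal_re]
  · rw [laplace_ofReal, laplace_ofReal] at heq
    exact_mod_cast heq

theorem tsum_mul_exp_mul_gammaKernel (β θ s : ℝ) (η : ℕ → ℝ) (x : ℝ) :
    ∑' i : ℕ, η i * (Real.exp (-s * x) * gammaKernel (i * θ + β) x) =
      Real.exp (-s * x) * borelTransform β θ η x := by
  rw [borelTransform_eq, ← tsum_mul_left]
  exact tsum_congr fun i => mul_left_comm _ _ _

theorem summable_integral_norm_mul_exp_mul_gammaKernel (hβ : 0 < β) (hθ : 0 ≤ θ) (hs : 0 < s)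
    (h : Summable fun i : ℕ => η i * s ^ (-(i * θ + β))) :
    Summable fun i : ℕ => ∫ x in Set.Ioi 0,
      ‖η i * (Real.exp (-s * x) * gammaKernel (i * θ + β) x)‖ := by
  refine summable_integral_norm_const_mul (fun i => ?_) ?_
  · filter_upwards [ae_restrict_mem measurableSet_Ioi] with x hx
    exact mul_nonneg (Real.exp_nonneg _) (gammaKernel_nonneg (by positivity) (le_of_lt hx))
  · simpa (disch := positivity) only [integral_exp_mul_gammaKernel] using h

theorem borelSummable_of_summable_rpow (hβ : 0 < β) (hθ : 0 ≤ θ) (hs : 0 < s)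
    (h : Summable fun i : ℕ => η i * s ^ (-(i * θ + β))) : BorelSummable β θ η := by
  intro x hx
  have hae := ae_restrict_of_ae_restrict_of_subset (Set.Ioi_subset_Ioi hx.le)
    (ae_summable_norm_of_summable_integral_norm
      (fun _ => (integrableOn_exp_mul_gammaKernel (by positivity) hs).const_mul _)
      (summable_integral_norm_mul_exp_mul_gammaKernel hβ hθ hs h))
  have : (ae (volume.restrict (Set.Ioi x))).NeBot := ae_restrict_neBot.2 (by simp)
  obtain ⟨y, hy, hxy⟩ := (hae.and (ae_restrict_mem measurableSet_Ioi)).exists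
  refine summable_mul_gammaKernel_of_le hβ hθ hx (le_of_lt hxy) ?_
  refine (hy.of_norm.mul_left (Real.exp (-s * y))⁻¹).congr fun i => ?_
  rw [mul_left_comm, inv_mul_cancel_left₀ (Real.exp_ne_zero _)]

theorem integrableOn_exp_mul_borelTransform (hβ : 0 < β) (hθ : 0 ≤ θ) (hs : 0 < s)
    (h : Summable fun i : ℕ => η i * s ^ (-(i * θ + β))) :
    IntegrableOn (fun x => Real.exp (-s * x) * borelTransform β θ η x) (Set.Ioi 0) := by
  simp only [← tsum_mul_exp_mul_gammaKernel]
  exact integrable_tsum_of_summable_integral_norm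
    (fun _ => (integrableOn_exp_mul_gammaKernel (by positivity) hs).const_mul _)
    (summable_integral_norm_mul_exp_mul_gammaKernel hβ hθ hs h)

theorem integral_exp_mul_borelTransform (hβ : 0 < β) (hθ : 0 ≤ θ) (hs : 0 < s)
    (h : Summable fun i : ℕ => η i * s ^ (-(i * θ + β))) :
    ∫ x in Set.Ioi 0, Real.exp (-s * x) * borelTransform β θ η x =
      ∑' i : ℕ, η i * s ^ (-(i * θ + β)) := by
  have hsum := hasSum_integral_of_summable_integral_norm
    (fun _ => (integrableOn_exp_mul_gammaKernel (by positivity) hs).const_mul _)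
    (summable_integral_norm_mul_exp_mul_gammaKernel hβ hθ hs h)
  simp (disch := positivity) only [integral_const_mul, integral_exp_mul_gammaKernel,
    tsum_mul_exp_mul_gammaKernel] at hsum
  exact hsum.tsum_eq.symm

theorem HasConvergentForm.hasRealBorelForm (hβ : 0 < β) (hθ : 0 ≤ θ)
    (h : HasConvergentForm f Ψ β θ η) : HasRealBorelForm f Ψ β θ η := by
  obtain ⟨σ, hσ, hlaplace⟩ := h
  have hreal : ∀ s : ℝ, σ < s → (Summable fun i : ℕ => η i * s ^ (-(i * θ + β))) ∧
      ∫ x in Set.Ioi 0, Real.exp (-s * x) * f x = Ψ * ∑' i : ℕ, η i * s ^ (-(i * θ + β)) := by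
    intro s hs
    obtain ⟨hsum, heq⟩ := hlaplace s (by simpa using hs)
    simp only [laplace_ofReal, laplaceTerm_ofReal β θ η (hσ.trans hs).le] at hsum heq
    exact ⟨Complex.summable_ofReal.1 hsum.of_norm, by exact_mod_cast heq⟩
  refine ⟨borelSummable_of_summable_rpow hβ hθ (hσ.trans (lt_add_one σ))
    (hreal (σ + 1) (lt_add_one σ)).1, σ, hσ, fun s hs => ?_⟩
  obtain ⟨hsum, heq⟩ := hreal s hs
  exact ⟨integrableOn_exp_mul_borelTransform hβ hθ (hσ.trans hs) hsum,
    heq.trans (by rw [integral_exp_mul_borelTransform hβ hθ (hσ.trans hs) hsum])⟩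

theorem HasLaplaceForm.hasRealBorelForm (hβ : 0 < β) (hθ : 0 < θ)
    (h : HasLaplaceForm f Ψ β θ η) : HasRealBorelForm f Ψ β θ η :=
  h.elim (·.hasRealBorelForm hβ hθ.le) (·.hasRealBorelForm hβ hθ)

theorem integrableOn_exp_neg_mul (hs : 0 ≤ s) (hf : IntegrableOn f (Set.Ioi 0)) :
    IntegrableOn (fun x => Real.exp (-s * x) * f x) (Set.Ioi 0) := by
  refine hf.bdd_mul (c := 1) (by fun_prop) ?_
  filter_upwards [ae_restrict_mem measurableSet_Ioi] with x hx
  rw [Real.norm_of_nonneg (Real.exp_nonneg _), Real.exp_le_one_iff, neg_mul]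
  exact neg_nonpos.2 (mul_nonneg hs (le_of_lt hx))

theorem HasRealBorelForm.ae_eq (h : HasRealBorelForm f Ψ β θ η) (hf : IntegrableOn f (Set.Ioi 0)) :
    f =ᵐ[volume.restrict (Set.Ioi 0)] fun x => Ψ * borelTransform β θ η x := by
  obtain ⟨-, σ, hσ, hlaplace⟩ := h
  have hf_exp := fun s (hs : σ < s) => integrableOn_exp_neg_mul (hσ.trans hs).le hf
  have hB_exp := fun s (hs : σ < s) => (hlaplace s hs).1.const_mul Ψ
  have hsub : ∀ s, (fun x => Real.exp (-s * x) * (f x - Ψ * borelTransform β θ η x)) = fun x =>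
      Real.exp (-s * x) * f x - Ψ * (Real.exp (-s * x) * borelTransform β θ η x) :=
    fun s => funext fun x => by ring
  have hzero : (fun x => f x - Ψ * borelTransform β θ η x) =ᵐ[volume.restrict (Set.Ioi 0)] 0 := by
    refine ae_eq_zero_of_integral_exp_neg_mul_eq_zero (σ := σ) (fun s hs => ?_) fun s hs => ?_
    · rw [hsub]
      exact (hf_exp s hs).sub (hB_exp s hs)
    · rw [hsub, integral_sub (hf_exp s hs) (hB_exp s hs), integral_const_mul, (hlaplace s hs).2,
        sub_self]
  exact hzero.mono fun x hx => sub_eq_zero.1 hx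

end LaplaceTransform

section Law

theorem nonneg_of_ae_nonneg {Y : Type*} [TopologicalSpace Y] [MeasurableSpace Y] {μ : Measure Y}
    [μ.IsOpenPosMeasure] {U : Set Y} (hU : IsOpen U) {f : Y → ℝ} (hf : ContinuousOn f U)
    (hnonneg : 0 ≤ᵐ[μ.restrict U] f) : ∀ x ∈ U, 0 ≤ f x := by
  have hmax : f =ᵐ[μ.restrict U] fun x => max (f x) 0 :=
    hnonneg.mono fun x hx => (max_eq_left hx).symm
  have heq := Measure.eqOn_of_ae_eq hmax hf (hf.sup continuousOn_const)
    (hU.interior_eq.symm ▸ subset_closure)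
  exact fun x hx => max_eq_left_iff.1 (heq hx).symm

theorem conv_withDensity_Ioi {f g : ℝ → ENNReal} (hf : AEMeasurable f (volume.restrict (Set.Ioi 0)))
    (hg : AEMeasurable g (volume.restrict (Set.Ioi 0))) :
    (volume.restrict (Set.Ioi 0)).withDensity f ∗ (volume.restrict (Set.Ioi 0)).withDensity g =
      (volume.restrict (Set.Ioi 0)).withDensity
        fun x => ∫⁻ y in Set.Ioo 0 x, f y * g (x - y) := by
  simp only [← withDensity_indicator measurableSet_Ioi]
  rw [conv_withDensity_eq_mlconvolution₀ ((aemeasurable_indicator_iff measurableSet_Ioi).2 hf)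
    ((aemeasurable_indicator_iff measurableSet_Ioi).2 hg)]
  congr 1
  ext x
  have hind : ∀ y, (Set.Ioi 0).indicator f y * (Set.Ioi 0).indicator g (-y + x) =
      (Set.Ioo 0 x).indicator (fun y => f y * g (x - y)) y := by
    intro y
    rw [neg_add_eq_sub, ← Set.Ioi_inter_Iio, Set.inter_indicator_mul]
    congr 1
    by_cases hy : y < x <;> simp [hy]
  rw [lconvolution_def]
  simp only [hind, lintegral_indicator measurableSet_Ioo]
  by_cases hx : 0 < x
  · rw [Set.indicator_of_mem (Set.mem_Ioi.2 hx)]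
  · simp [hx]

variable {Ω : Type*} [MeasurableSpace Ω] {P : Measure Ω}

theorem integrable_density [IsFiniteMeasure P] {X : Ω → ℝ} [HasPDF X P volume] :
    Integrable (density P X) := by
  refine integrable_toReal_of_lintegral_ne_top (measurable_pdf X P volume).aemeasurable ?_
  rw [pdf.lintegral_eq_measure_univ]
  exact measure_ne_top _ _

theorem map_eq_withDensity_density [IsFiniteMeasure P] {X : Ω → ℝ} [HasPDF X P volume]
    (hX : ∀ᵐ ω ∂P, 0 ≤ X ω) : P.map X =
      (volume.restrict (Set.Ioi 0)).withDensity fun x => ENNReal.ofReal (density P X x) := by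
  have hX_map : ∀ᵐ x ∂(P.map X), 0 ≤ x :=
    (ae_map_iff (HasPDF.aemeasurable X P volume) measurableSet_Ici).2 hX
  have hne : ∀ᵐ x ∂(P.map X), x ≠ 0 :=
    (HasPDF.absolutelyContinuous : P.map X ≪ volume).ae_le (Measure.ae_ne volume 0)
  have hpos : ∀ᵐ x ∂(P.map X), x ∈ Set.Ioi 0 := by
    filter_upwards [hX_map, hne] with x hx hx0 using lt_of_le_of_ne hx hx0.symm
  rw [← Measure.restrict_eq_self_of_ae_mem hpos, map_eq_withDensity_pdf X P volume,
    restrict_withDensity measurableSet_Ioi]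
  have hfin : ∀ᵐ x : ℝ, pdf X P volume x < ⊤ := pdf.ae_lt_top
  refine withDensity_congr_ae ((ae_restrict_of_ae hfin).mono fun x hx => ?_)
  exact (ENNReal.ofReal_toReal hx.ne).symm

/-- The measure `μ` is carried by `(0, ∞)` and has there the density `Ψ * borelTransform α θ a`,
a convergent series of Riemann–Liouville kernels. -/
structure HasBorelDensity (μ : Measure ℝ) (Ψ α θ : ℝ) (a : ℕ → ℝ) : Prop where
  borelSummable : BorelSummable α θ a
  nonneg : ∀ x : ℝ, 0 < x → 0 ≤ Ψ * borelTransform α θ a x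
  eq_withDensity : μ = (volume.restrict (Set.Ioi 0)).withDensity
    fun x => ENNReal.ofReal (Ψ * borelTransform α θ a x)

theorem HasRealBorelForm.hasBorelDensity_map [IsFiniteMeasure P] {X : Ω → ℝ} [HasPDF X P volume]
    (hX : ∀ᵐ ω ∂P, 0 ≤ X ω) {Ψ β θ : ℝ} {η : ℕ → ℝ} (hβ : 0 < β) (hθ : 0 ≤ θ)
    (h : HasRealBorelForm (density P X) Ψ β θ η) : HasBorelDensity (P.map X) Ψ β θ η := by
  have hae := h.ae_eq integrable_density.integrableOn
  refine ⟨h.1, nonneg_of_ae_nonneg isOpen_Ioi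
    (continuousOn_const.mul (continuousOn_borelTransform hβ hθ h.1))
    (hae.mono fun x hx => hx ▸ ENNReal.toReal_nonneg), ?_⟩
  rw [map_eq_withDensity_density hX]
  exact withDensity_congr_ae (hae.mono fun x hx => congrArg ENNReal.ofReal hx)

namespace HasBorelDensity

variable {μ ν : Measure ℝ} {Ψ Φ α β θ x : ℝ} {a b c : ℕ → ℝ}

theorem aemeasurable (hα : 0 < α) (hθ : 0 ≤ θ) (h : HasBorelDensity μ Ψ α θ a) :
    AEMeasurable (fun x => ENNReal.ofReal (Ψ * borelTransform α θ a x))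
      (volume.restrict (Set.Ioi 0)) :=
  (((continuousOn_borelTransform hα hθ h.borelSummable).aemeasurable
    measurableSet_Ioi).const_mul Ψ).ennreal_ofReal

theorem lintegral_mul (hα : 0 < α) (hβ : 0 < β) (hθ : 0 ≤ θ)
    (hc : PowerSeries.mk c = PowerSeries.mk a * PowerSeries.mk b)
    (hμ : HasBorelDensity μ Ψ α θ a) (hν : HasBorelDensity ν Φ β θ b) (hx : 0 < x) :
    ∫⁻ y in Set.Ioo 0 x, ENNReal.ofReal (Ψ * borelTransform α θ a y) *
        ENNReal.ofReal (Φ * borelTransform β θ b (x - y)) =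
      ENNReal.ofReal (Ψ * Φ * borelTransform (α + β) θ c x) := by
  rw [← integral_borelTransform_mul_borelTransform hα hβ hθ hc hμ.borelSummable hν.borelSummable
    hx, ← integral_const_mul, ofReal_integral_eq_lintegral_ofReal
    ((integrableOn_borelTransform_mul_borelTransform hα hβ hθ hμ.borelSummable hν.borelSummable
      hx).const_mul _)]
  · refine setLIntegral_congr_fun measurableSet_Ioo fun y hy => ?_
    rw [← ENNReal.ofReal_mul (hμ.nonneg y hy.1), mul_mul_mul_comm]
  · filter_upwards [ae_restrict_mem measurableSet_Ioo] with y hy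
    rw [Pi.zero_apply, mul_mul_mul_comm]
    exact mul_nonneg (hμ.nonneg y hy.1) (hν.nonneg _ (sub_pos.2 hy.2))

theorem conv (hα : 0 < α) (hβ : 0 < β) (hθ : 0 ≤ θ)
    (hc : PowerSeries.mk c = PowerSeries.mk a * PowerSeries.mk b)
    (hμ : HasBorelDensity μ Ψ α θ a) (hν : HasBorelDensity ν Φ β θ b) :
    HasBorelDensity (μ ∗ ν) (Ψ * Φ) (α + β) θ c where
  borelSummable := hμ.borelSummable.mul hα hβ hθ hc hν.borelSummable
  nonneg x hx := by
    rw [← integral_borelTransform_mul_borelTransform hα hβ hθ hc hμ.borelSummable hν.borelSummable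
      hx, ← integral_const_mul]
    refine setIntegral_nonneg measurableSet_Ioo fun y hy => ?_
    rw [mul_mul_mul_comm]
    exact mul_nonneg (hμ.nonneg y hy.1) (hν.nonneg _ (sub_pos.2 hy.2))
  eq_withDensity := by
    rw [hμ.eq_withDensity, hν.eq_withDensity,
      conv_withDensity_Ioi (hμ.aemeasurable hα hθ) (hν.aemeasurable hβ hθ)]
    exact withDensity_congr_ae ((ae_restrict_mem measurableSet_Ioi).mono fun x hx =>
      hμ.lintegral_mul hα hβ hθ hc hν hx)

theorem map_sum {ι : Type*} {X : ι → Ω → ℝ} {Ψ β : ι → ℝ} {η : ι → ℕ → ℝ}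
    (hindep : iIndepFun X P) (hmeas : ∀ l, AEMeasurable (X l) P) (hβ : ∀ l, 0 < β l) (hθ : 0 ≤ θ)
    (hX : ∀ l, HasBorelDensity (P.map (X l)) (Ψ l) (β l) θ (η l)) {s : Finset ι}
    (hs : s.Nonempty) {δ : ℕ → ℝ} (hδ : PowerSeries.mk δ = ∏ l ∈ s, PowerSeries.mk (η l)) :
    HasBorelDensity (P.map (∑ l ∈ s, X l)) (∏ l ∈ s, Ψ l) (∑ l ∈ s, β l) θ δ := by
  have := hindep.isProbabilityMeasure
  induction hs using Finset.Nonempty.cons_induction generalizing δ with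
  | singleton l =>
    obtain rfl : δ = η l := funext fun n => by simpa using congrArg (PowerSeries.coeff n) hδ
    simpa using hX l
  | cons l s hl hs ih =>
    have hmk : PowerSeries.mk (fun n => PowerSeries.coeff n (∏ l ∈ s, PowerSeries.mk (η l))) =
        ∏ l ∈ s, PowerSeries.mk (η l) := PowerSeries.ext fun n => PowerSeries.coeff_mk _ _
    have hsum := ih hmk
    rw [Finset.prod_cons, ← hmk] at hδ
    rw [Finset.sum_cons, Finset.prod_cons, Finset.sum_cons,
      (hindep.indepFun_finsetSum_of_notMem₀ hmeas hl).symm.map_add_eq_map_conv_map₀ (hmeas l)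
        (Finset.aemeasurable_sum _ fun i _ => hmeas i)]
    exact (hX l).conv (hβ l) (Finset.sum_pos (fun i _ => hβ i) hs) hθ hδ hsum

theorem hasPDF {X : Ω → ℝ} (hX : AEMeasurable X P) (hα : 0 < α) (hθ : 0 ≤ θ)
    (h : HasBorelDensity (P.map X) Ψ α θ a) : HasPDF X P volume := by
  refine hasPDF_of_map_eq_withDensity hX _
    ((aemeasurable_indicator_iff measurableSet_Ioi).2 (h.aemeasurable hα hθ)) ?_
  rw [withDensity_indicator measurableSet_Ioi, h.eq_withDensity]

theorem measureReal_Iic (hα : 0 < α) (hθ : 0 ≤ θ) (h : HasBorelDensity μ Ψ α θ a) (hx : 0 ≤ x) :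
    μ.real (Set.Iic x) = Ψ * borelTransform (α + 1) θ a x := by
  have hnonneg : 0 ≤ᵐ[volume.restrict (Set.Ioo 0 x)] fun y => Ψ * borelTransform α θ a y := by
    filter_upwards [ae_restrict_mem measurableSet_Ioo] with y hy using h.nonneg y hy.1
  have hint := (integrableOn_borelTransform hα hθ h.borelSummable x).const_mul Ψ
  rw [← integral_borelTransform hα hθ h.borelSummable hx, ← integral_const_mul,
    integral_eq_lintegral_of_nonneg_ae hnonneg hint.1, measureReal_def, h.eq_withDensity,
    withDensity_apply _ measurableSet_Iic, Measure.restrict_restrict measurableSet_Iic,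
    Set.inter_comm, Set.Ioi_inter_Iic, restrict_Ioo_eq_restrict_Ioc]

end HasBorelDensity

end Law

end LaplaceSum

theorem corollary1_general {Ω : Type*} [MeasurableSpace Ω] (P : Measure Ω) {ι : Type*} [Fintype ι]
    [Nonempty ι] (X : ι → Ω → ℝ) (hindep : iIndepFun X P) (hpdf : ∀ l, HasPDF (X l) P volume)
    (hnonneg : ∀ l, ∀ᵐ ω ∂P, 0 ≤ X l ω) (Ψ β : ι → ℝ) (θ : ℝ) (hβ : ∀ l, 0 < β l) (hθ : 0 < θ)
    (η : ι → ℕ → ℝ)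
    (hform : ∀ l, LaplaceSum.HasLaplaceForm (LaplaceSum.density P (X l)) (Ψ l) (β l) θ (η l))
    (δ : ℕ → ℝ) (hδ : PowerSeries.mk δ = ∏ l, PowerSeries.mk (η l)) :
    (∀ x : ℝ, 0 < x → Summable fun i : ℕ =>
      |δ i * x ^ (-1 + θ * (i : ℝ) + ∑ l, β l) / Real.Gamma ((i : ℝ) * θ + ∑ l, β l)|) ∧
    (∀ x : ℝ, 0 < x → 0 ≤ (∏ l, Ψ l) * ∑' i : ℕ,
      δ i * x ^ (-1 + θ * (i : ℝ) + ∑ l, β l) / Real.Gamma ((i : ℝ) * θ + ∑ l, β l)) ∧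
    HasPDF (fun ω => ∑ l, X l ω) P volume ∧
    P.map (fun ω => ∑ l, X l ω) = (volume.restrict (Set.Ioi 0)).withDensity (fun x : ℝ =>
      ENNReal.ofReal ((∏ l, Ψ l) * ∑' i : ℕ,
        δ i * x ^ (-1 + θ * (i : ℝ) + ∑ l, β l) / Real.Gamma ((i : ℝ) * θ + ∑ l, β l))) ∧
    (∀ x : ℝ, 0 ≤ x → Summable fun i : ℕ =>
      |δ i * x ^ (θ * (i : ℝ) + ∑ l, β l) / Real.Gamma (1 + (i : ℝ) * θ + ∑ l, β l)|) ∧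
    (∀ x : ℝ, 0 ≤ x → P.real {ω | ∑ l, X l ω ≤ x} = (∏ l, Ψ l) * ∑' i : ℕ,
      δ i * x ^ (θ * (i : ℝ) + ∑ l, β l) / Real.Gamma (1 + (i : ℝ) * θ + ∑ l, β l)) := by
  have := hindep.isProbabilityMeasure
  have hmeas : ∀ l, AEMeasurable (X l) P := fun l => HasPDF.aemeasurable (X l) P volume
  have hsum_meas : AEMeasurable (fun ω => ∑ l, X l ω) P :=
    Finset.aemeasurable_fun_sum _ fun l _ => hmeas l
  have hβ_sum : 0 < ∑ l, β l := Finset.sum_pos (fun l _ => hβ l) Finset.univ_nonempty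
  have hsum : LaplaceSum.HasBorelDensity (P.map fun ω => ∑ l, X l ω) (∏ l, Ψ l) (∑ l, β l) θ δ := by
    rw [← Finset.sum_fn]
    exact LaplaceSum.HasBorelDensity.map_sum hindep hmeas hβ hθ.le
      (fun l => ((hform l).hasRealBorelForm (hβ l) hθ).hasBorelDensity_map (hnonneg l) (hβ l) hθ.le)
      Finset.univ_nonempty hδ
  refine ⟨fun x hx => hsum.borelSummable.summable_abs hx, hsum.nonneg,
    hsum.hasPDF hsum_meas hβ_sum hθ.le, hsum.eq_withDensity,
    fun x hx => hsum.borelSummable.summable_abs_add_one hβ_sum hθ.le hx, fun x hx => ?_⟩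
  rw [← LaplaceSum.borelTransform_add_one_eq, ← hsum.measureReal_Iic hβ_sum hθ.le hx,
    map_measureReal_apply_of_aemeasurable hsum_meas measurableSet_Iic]
  rfl

theorem corollary1 {Ω : Type*} [MeasurableSpace Ω] (P : Measure Ω) [IsProbabilityMeasure P]
    (L : ℕ) (hL : 1 ≤ L) (X : Fin L → Ω → ℝ)
    (hindep : iIndepFun X P)
    (hpdf : ∀ l, HasPDF (X l) P volume)
    (hnonneg : ∀ l, ∀ᵐ ω ∂P, 0 ≤ X l ω)
    (Ψ β θ : ℝ) (hΨ : 0 < Ψ) (hβ : 0 < β) (hθ : 0 < θ)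
    (η : ℕ → ℝ) (hη : η 0 ≠ 0)
    (hform : ∀ l, LaplaceSum.HasLaplaceForm (LaplaceSum.density P (X l)) Ψ β θ η) :
    -- the probability density function of the sum
    (∀ x : ℝ, 0 < x → Summable fun i : ℕ =>
      |LaplaceSum.delta η L i * x ^ (-1 + θ * (i : ℝ) + (L : ℝ) * β) /
        Real.Gamma ((i : ℝ) * θ + (L : ℝ) * β)|) ∧
    (∀ x : ℝ, 0 < x → 0 ≤ Ψ ^ L * ∑' i : ℕ,
      LaplaceSum.delta η L i * x ^ (-1 + θ * (i : ℝ) + (L : ℝ) * β) /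
        Real.Gamma ((i : ℝ) * θ + (L : ℝ) * β)) ∧
    HasPDF (fun ω => ∑ l, X l ω) P volume ∧
    P.map (fun ω => ∑ l, X l ω) = (volume.restrict (Set.Ioi 0)).withDensity (fun x : ℝ =>
      ENNReal.ofReal (Ψ ^ L * ∑' i : ℕ,
        LaplaceSum.delta η L i * x ^ (-1 + θ * (i : ℝ) + (L : ℝ) * β) /
          Real.Gamma ((i : ℝ) * θ + (L : ℝ) * β))) ∧
    -- the cumulative distribution function of the sum
    (∀ x : ℝ, 0 ≤ x → Summable fun i : ℕ =>
      |LaplaceSum.delta η L i * x ^ (θ * (i : ℝ) + (L : ℝ) * β) /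
        Real.Gamma (1 + (i : ℝ) * θ + (L : ℝ) * β)|) ∧
    (∀ x : ℝ, 0 ≤ x → P.real {ω | ∑ l, X l ω ≤ x} = Ψ ^ L * ∑' i : ℕ,
      LaplaceSum.delta η L i * x ^ (θ * (i : ℝ) + (L : ℝ) * β) /
        Real.Gamma (1 + (i : ℝ) * θ + (L : ℝ) * β)) ∧
    -- the coefficients are those of the `L`-th power of the power series `∑ η_i z^i`
    PowerSeries.mk (LaplaceSum.delta η L) = PowerSeries.mk η ^ L := by
  have : Nonempty (Fin L) := ⟨⟨0, hL⟩⟩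
  have hsum := corollary1_general P X hindep hpdf hnonneg (fun _ => Ψ) (fun _ => β) θ (fun _ => hβ)
    hθ (fun _ => η) hform (LaplaceSum.delta η L) (by simpa using LaplaceSum.mk_delta hη L)
  simp only [Finset.prod_const, Finset.sum_const, Finset.card_univ, Fintype.card_fin,
    nsmul_eq_mul] at hsum
  obtain ⟨hpdf_summable, hpdf_nonneg, hhasPDF, hmap, hcdf_summable, hcdf⟩ := hsum
  exact ⟨hpdf_summable, hpdf_nonneg, hhasPDF, hmap, hcdf_summable, hcdf, LaplaceSum.mk_delta hη L⟩
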